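/- Let $G$ be a finite simple graph with at least one vertex that is an outer-string graph, that is, the intersection graph of a family of curves in a closed disk such that each curve has an endpoint on the boundary circle of the disk (the vertices of $G$ correspond to the curves, and two distinct vertices are adjacent if and only if the corresponding curves have a common point). Then $$\mathrm{tw}(G) \leq 15\,\mathrm{had}(G) - 2,$$ where the treewidth $\mathrm{tw}(G)$ is the minimum, over all tree-decompositions of $G$, of the maximum size of a bag minus one, and the Hadwiger number $\mathrm{had}(G)$ is the maximum integer $t$ such that the complete graph $K_t$ is a minor of $G$. -/

import Mathlib

namespace SimpleGraph

universe u v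

/-- A (finite) tree-decomposition of a graph `G`: a finite tree together with a bag of vertices of
`G` at every node, such that every edge lies in some bag, and, for every vertex, the nodes whose
bags contain it induce a non-empty connected subgraph of the tree. Every finite tree is
isomorphic to one whose nodes form a type in `Type`. -/
structure TreeDecomposition {V : Type u} (G : SimpleGraph V) where
  Node : Type
  [fintypeNode : Fintype Node]
  tree : SimpleGraph Node
  isTree : tree.IsTree
  bag : Node → Finset V
  edge_covered : ∀ v w : V, G.Adj v w → ∃ x : Node, v ∈ bag x ∧ w ∈ bag x
  vertex_connected : ∀ v : V, (tree.induce {x : Node | v ∈ bag x}).Connected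

attribute [instance] TreeDecomposition.fintypeNode

/-- The width of a tree-decomposition: the maximum size of a bag, minus one. -/
def TreeDecomposition.width {V : Type u} {G : SimpleGraph V} (D : TreeDecomposition G) : ℤ :=
  ((Finset.univ.sup fun x : D.Node => (D.bag x).card : ℕ) : ℤ) - 1

/-- The treewidth of a graph: the minimum width of a tree-decomposition. For a finite graph the
minimum is attained, see `isLeast_treewidth`. -/
noncomputable def treewidth {V : Type u} (G : SimpleGraph V) : ℤ :=
  sInf {k : ℤ | ∃ D : TreeDecomposition G, D.width = k}

/-- `H` is a minor of `G`: there are pairwise disjoint connected (in particular non-empty) sets of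
vertices of `G`, one for each vertex of `H`, such that there is an edge of `G` between any two of
them that belong to adjacent vertices of `H`. -/
def IsMinor {W : Type v} {V : Type u} (H : SimpleGraph W) (G : SimpleGraph V) : Prop :=
  ∃ B : W → Set V,
    (∀ a : W, (G.induce (B a)).Connected) ∧
    (∀ a b : W, a ≠ b → Disjoint (B a) (B b)) ∧
    (∀ a b : W, H.Adj a b → ∃ x ∈ B a, ∃ y ∈ B b, G.Adj x y)

/-- The Hadwiger number of a graph: the maximum `t` such that the complete graph on `t` vertices is
a minor. For a finite graph the maximum is attained, see `isGreatest_hadwigerNumber`. -/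
noncomputable def hadwigerNumber {V : Type u} (G : SimpleGraph V) : ℕ :=
  sSup {t : ℕ | IsMinor (⊤ : SimpleGraph (Fin t)) G}

/-- `G` is an outer-string graph: it is the intersection graph of a family of curves (continuous
images of the unit interval) in the closed unit disk of the plane, each of which has at least one
of its two endpoints on the boundary circle of the disk. -/
def IsOuterString {V : Type u} (G : SimpleGraph V) : Prop :=
  ∃ γ : V → C(unitInterval, ℂ),
    (∀ v : V, Set.range (γ v) ⊆ Metric.closedBall (0 : ℂ) 1) ∧
    (∀ v : V, γ v 0 ∈ Metric.sphere (0 : ℂ) 1 ∨ γ v 1 ∈ Metric.sphere (0 : ℂ) 1) ∧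
    (∀ v w : V, G.Adj v w ↔ v ≠ w ∧ (Set.range (γ v) ∩ Set.range (γ w)).Nonempty)

theorem isLeast_treewidth {V : Type u} [Finite V] (G : SimpleGraph V) :
    IsLeast {k : ℤ | ∃ D : TreeDecomposition G, D.width = k} G.treewidth := by
  have := Fintype.ofFinite V
  have hb : BddBelow {k : ℤ | ∃ D : TreeDecomposition G, D.width = k} := by
    refine ⟨-1, ?_⟩
    rintro k ⟨D, rfl⟩
    unfold TreeDecomposition.width
    omega
  have hne : {k : ℤ | ∃ D : TreeDecomposition G, D.width = k}.Nonempty := by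
    refine ⟨_, ⟨Unit, ⊥, IsTree.of_subsingleton, fun _ => Finset.univ, ?_, ?_⟩, rfl⟩
    · intro v w _
      exact ⟨(), by simp⟩
    · intro v
      have : Nonempty {x : Unit | v ∈ (Finset.univ : Finset V)} := ⟨⟨(), by simp⟩⟩
      exact ⟨Preconnected.of_subsingleton⟩
  exact ⟨Int.csInf_mem hne hb, fun k hk => csInf_le hb hk⟩

theorem isGreatest_hadwigerNumber {V : Type u} [Finite V] (G : SimpleGraph V) :
    IsGreatest {t : ℕ | IsMinor (⊤ : SimpleGraph (Fin t)) G} G.hadwigerNumber := by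
  have hb : BddAbove {t : ℕ | IsMinor (⊤ : SimpleGraph (Fin t)) G} := by
    refine ⟨Nat.card V, ?_⟩
    rintro t ⟨B, hc, hd, -⟩
    have hn : ∀ a, ∃ x, x ∈ B a := fun a => by
      obtain ⟨x⟩ := (hc a).nonempty
      exact ⟨x.1, x.2⟩
    choose f hf using hn
    have hinj : Function.Injective f := by
      intro a b hab
      by_contra hne
      exact Set.disjoint_left.1 (hd a b hne) (hf a) (hab ▸ hf b)
    simpa using Nat.card_le_card_of_injective f hinj
  have hne : {t : ℕ | IsMinor (⊤ : SimpleGraph (Fin t)) G}.Nonempty :=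
    ⟨0, fun a => a.elim0, fun a => a.elim0, fun a => a.elim0, fun a => a.elim0⟩
  exact ⟨Nat.sSup_mem hne hb, fun t ht => le_csSup hb ht⟩

end SimpleGraph

/-! Write `h` for the Hadwiger number. It controls balanced separators, and balanced separators
yield a tree-decomposition.

Number the vertices by the angle of an endpoint of their curve on the circle. If disjoint connected
sets `C` and `D` contain vertices numbered `c < d < c' < d'`, the unions of their curves are
path-connected subsets of the disk that join interleaving boundary points. Such sets meet
(`Complex.exists_eq_of_interleaving`), which gives an edge between `C` and `D`.

Cut a set `S` of `3(3h+1)` vertices into three consecutive intervals of equal size. Two disjoint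
connected sets that each meet all three intervals always interleave, hence are adjacent, so `h+1`
pairwise disjoint ones would give a `K_{h+1}` minor. Menger's theorem in three auxiliary graphs then
gives a set `X` of at most `3h` vertices such that every component of `G - X` misses an interval
(`exists_separator_of_three_coloring`). A component thus contains at most `6h+2` vertices of `S`,
and `(6h+2) + 3h < |S|`.

Recursive splitting along such `X` (`HasSeparators.decomposable_union`) gives bags of size at most
`12h+3`, so the treewidth is at most `12h+2`, which is at most `15h-2` as soon as `h ≥ 2`. Edgeless
graphs are treated separately. -/

/-! ### Crossing paths in the disk, by variation of the argument. -/

section Crossing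

open Complex in
theorem Complex.one_sub_exp_mul_I (φ : ℝ) :
    1 - exp (φ * I) = (2 * Real.sin (φ / 2) : ℝ) * exp (((φ - Real.pi) / 2 : ℝ) * I) := by
  have h1 : exp (φ * I) = exp ((φ / 2 : ℝ) * I) ^ 2 := by
    rw [← Complex.exp_nat_mul]; congr 1; push_cast; ring
  have h2 : exp (((φ - Real.pi) / 2 : ℝ) * I) = exp ((φ / 2 : ℝ) * I) * (-I) := by
    rw [← Complex.exp_neg_pi_div_two_mul_I, ← Complex.exp_add]; congr 1; push_cast; ring
  rw [h1, h2, Complex.exp_mul_I, ← Complex.ofReal_cos, ← Complex.ofReal_sin]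
  have h3 := Real.sin_sq_add_cos_sq (φ / 2)
  generalize Real.sin (φ / 2) = x at *
  generalize Real.cos (φ / 2) = y at *
  apply Complex.ext
  · simp [pow_two]; linarith
  · simp [pow_two]; ring

open Complex in
theorem Complex.exists_im_eq_of_exp_eq {z : ℂ} {r ψ : ℝ} (hr : 0 < r)
    (h : exp z = r * exp (ψ * I)) : ∃ n : ℤ, z.im = ψ + n * (2 * Real.pi) := by
  have h1 : exp (z - (Real.log r : ℝ) - ψ * I) = 1 := by
    rw [exp_sub, exp_sub, h, ← ofReal_exp, Real.exp_log hr]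
    have h2 := exp_ne_zero (ψ * I)
    have h3 : (r : ℂ) ≠ 0 := by exact_mod_cast hr.ne'
    field_simp
  obtain ⟨n, hn⟩ := exp_eq_one_iff.1 h1
  refine ⟨n, ?_⟩
  have := congrArg Complex.im hn
  simp at this
  linarith

/-- By the intermediate value theorem `u` cannot pass a zero of the cosine, so it stays in a single
translate of `(-π/2, π/2)` by a multiple of `2π`, which forces `n = m`. -/
theorem Real.sub_eq_sub_of_cos_pos {u : ℝ → ℝ} (hu : Continuous u) (hc : ∀ t, 0 < Real.cos (u t))
    {a b : ℝ} {n m : ℤ} (ha : a < Real.pi / 2) (ha' : -(Real.pi / 2) < a)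
    (hb : b < Real.pi / 2) (hb' : -(Real.pi / 2) < b) {s t : ℝ}
    (hs : u s = a + n * (2 * Real.pi)) (ht : u t = b + m * (2 * Real.pi)) :
    u t - u s = b - a := by
  have key : ∀ {a b : ℝ} {n m : ℤ}, a < Real.pi / 2 → -(Real.pi / 2) < b → ∀ {s t : ℝ},
      u s = a + n * (2 * Real.pi) → u t = b + m * (2 * Real.pi) → m ≤ n := by
    intro a b n m ha hb s t hs ht
    by_contra! hlt
    have h1 : (n : ℝ) + 1 ≤ m := by exact_mod_cast hlt
    have hpi := Real.pi_pos
    have h2 : Real.pi / 2 + n * (2 * Real.pi) ∈ Set.uIcc (u s) (u t) := by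
      have : (n : ℝ) * (2 * Real.pi) + 2 * Real.pi ≤ m * (2 * Real.pi) := by nlinarith
      rw [Set.mem_uIcc]; left
      constructor <;> linarith
    obtain ⟨x, -, hx⟩ := intermediate_value_uIcc hu.continuousOn h2
    have := hc x
    rw [hx, Real.cos_add_int_mul_two_pi, Real.cos_pi_div_two] at this
    exact lt_irrefl _ this
  have h1 := key ha hb' hs ht
  have h2 := key hb ha' ht hs
  obtain rfl : n = m := le_antisymm h2 h1
  rw [hs, ht]; ring

theorem Complex.re_lt_one_of_norm_le_one {z : ℂ} (hz : ‖z‖ ≤ 1) (h : z ≠ 1) : z.re < 1 := by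
  have h1 : z.re ≤ 1 := (Complex.re_le_norm z).trans hz
  refine lt_of_le_of_ne h1 fun h2 => h ?_
  have h3 : z.re ^ 2 + z.im ^ 2 ≤ 1 := by
    have := Complex.sq_norm z
    rw [Complex.normSq_apply] at this
    nlinarith [pow_le_one₀ (norm_nonneg z) hz (n := 2)]
  apply Complex.ext
  · simpa using h2
  · rw [h2] at h3
    simp only [Complex.one_im]
    nlinarith

open Complex in
/-- The variation of the argument of `e ^ (iθ) - h` along a path `h` in the closed unit disk between
two points of the unit circle. -/
theorem Complex.im_sub_im_of_exp_eq_sub {θ β δ : ℝ} {L h : ℝ → ℂ} (hL : Continuous L)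
    (hh : ∀ t, ‖h t‖ ≤ 1) (hexp : ∀ t, exp (L t) = exp (θ * I) - h t)
    (h0 : h 0 = exp (β * I)) (h1 : h 1 = exp (δ * I))
    (hβ : θ < β) (hβ' : β < θ + 2 * Real.pi) (hδ : θ < δ) (hδ' : δ < θ + 2 * Real.pi) :
    (L 1).im - (L 0).im = (δ - β) / 2 := by
  -- After rotation by `-θ` the vector is `1 - z` with `‖z‖ ≤ 1` and `z ≠ 1`, so it lies in the open
  -- right half-plane.
  have hpos : ∀ t, 0 < Real.cos ((L t).im - θ) := by
    intro t
    set z := exp (-(θ * I)) * h t with hz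
    have hz1 : ‖z‖ ≤ 1 := by
      have : ‖exp (-(θ * I))‖ = 1 := by
        have := Complex.norm_exp_ofReal_mul_I (-θ)
        rwa [ofReal_neg, neg_mul] at this
      rw [hz, norm_mul, this, one_mul]
      exact hh t
    have he : exp (L t - θ * I) = 1 - z := by
      rw [sub_eq_add_neg, exp_add, hexp, sub_mul, ← exp_add, add_neg_cancel, exp_zero, hz]
      ring
    have hz2 : z ≠ 1 := by
      intro h
      rw [h, sub_self] at he
      exact exp_ne_zero _ he
    have h3 := re_lt_one_of_norm_le_one hz1 hz2
    have h4 := congrArg Complex.re he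
    rw [exp_re] at h4
    simp at h4
    have h5 : 0 < Real.exp (L t).re * Real.cos ((L t).im - θ) := by linarith
    exact pos_of_mul_pos_right h5 (Real.exp_pos _).le
  -- On the circle the argument is known up to `2π` by the half-angle formula for `1 - e^(iφ)`; it
  -- is the inscribed angle that makes the variation `(δ - β) / 2`.
  have hval : ∀ t γ, h t = exp ((γ : ℝ) * I) → θ < γ → γ < θ + 2 * Real.pi →
      ∃ n : ℤ, (L t).im - θ = (γ - θ - Real.pi) / 2 + n * (2 * Real.pi) := by
    intro t γ ht h5 h6
    have h7 : exp (L t) = (2 * Real.sin ((γ - θ) / 2) : ℝ) *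
        exp ((θ + (γ - θ - Real.pi) / 2 : ℝ) * I) := by
      have h8 := Complex.one_sub_exp_mul_I (γ - θ)
      have h9 : exp ((θ + (γ - θ - Real.pi) / 2 : ℝ) * I) =
          exp (θ * I) * exp (((γ - θ - Real.pi) / 2 : ℝ) * I) := by
        rw [← exp_add]; congr 1; push_cast; ring
      rw [h9, mul_left_comm, ← h8, hexp, ht, mul_sub, mul_one, ← exp_add]
      congr 2; push_cast; ring
    have h10 : 0 < 2 * Real.sin ((γ - θ) / 2) := by
      have := Real.sin_pos_of_pos_of_lt_pi (x := (γ - θ) / 2) (by linarith) (by linarith)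
      linarith
    obtain ⟨n, hn⟩ := exists_im_eq_of_exp_eq h10 h7
    exact ⟨n, by rw [hn]; ring⟩
  obtain ⟨n, hn⟩ := hval 0 β h0 hβ hβ'
  obtain ⟨m, hm⟩ := hval 1 δ h1 hδ hδ'
  have := Real.sub_eq_sub_of_cos_pos (u := fun t => (L t).im - θ) (by fun_prop) hpos
    (by linarith) (by linarith) (by linarith) (by linarith) hn hm
  linarith

open Complex in
/-- Two paths in the closed unit disk whose ends interleave on the unit circle meet. -/
theorem Complex.exists_eq_of_interleaving {a b c d : ℝ} (hab : a < b) (hbc : b < c) (hcd : c < d)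
    (hda : d < a + 2 * Real.pi) {f g : ℝ → ℂ} (hf : Continuous f) (hg : Continuous g)
    (hf1 : ∀ t, ‖f t‖ ≤ 1) (hg1 : ∀ t, ‖g t‖ ≤ 1)
    (hfa : f 0 = exp (a * I)) (hfc : f 1 = exp (c * I))
    (hgb : g 0 = exp (b * I)) (hgd : g 1 = exp (d * I)) : ∃ s t, f s = g t := by
  by_contra! hne
  have hsc : IsSimplyConnected (Set.univ : Set (ℝ × ℝ)) :=
    (Homeomorph.Set.univ (ℝ × ℝ)).toHomotopyEquiv.simplyConnectedSpace
  -- If the paths never met, `f s - g t` would be a nowhere zero function on the plane and would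
  -- have a continuous logarithm.
  obtain ⟨L, hL, hexp⟩ := Complex.exists_continuousOn_eqOn_exp_comp (X := ℝ × ℝ) hsc isOpen_univ
    (g := fun p => f p.1 - g p.2) (by fun_prop)
    (by rintro ⟨p, -, hp⟩; exact hne _ _ (sub_eq_zero.1 hp))
  rw [continuousOn_univ] at hL
  have hexp' : ∀ s t, exp (L (s, t)) = f s - g t := fun s t => hexp (Set.mem_univ (s, t))
  have hneg : ∀ s t, exp (L (s, t) + Real.pi * I) = g t - f s := by
    intro s t
    rw [exp_add, exp_pi_mul_I, hexp']; ring
  have hper : ∀ x : ℝ, exp ((x + 2 * Real.pi : ℝ) * I) = exp (x * I) := by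
    intro x
    rw [ofReal_add, add_mul]
    push_cast
    exact Complex.exp_periodic _
  -- The change of `L.im` along the four sides of the unit square; shifts by `2π` put every angle in
  -- the required window `(θ, θ + 2π)`. The two routes from `(0, 0)` to `(1, 1)` give changes that
  -- differ by `2π`, which is absurd.
  have s0 := im_sub_im_of_exp_eq_sub (θ := a) (L := fun t => L (0, t)) (h := g) (by fun_prop) hg1
    (fun t => by rw [hexp', hfa]) hgb hgd hab (by linarith) (by linarith) (by linarith)
  have s1 := im_sub_im_of_exp_eq_sub (θ := c) (β := b + 2 * Real.pi) (L := fun t => L (1, t))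
    (h := g) (by fun_prop) hg1 (fun t => by rw [hexp', hfc]) (by rw [hper, hgb]) hgd
    (by linarith) (by linarith) (by linarith) (by linarith)
  have t0 := im_sub_im_of_exp_eq_sub (θ := b) (β := a + 2 * Real.pi)
    (L := fun s => L (s, 0) + Real.pi * I)
    (h := f) (by fun_prop) hf1 (fun t => by rw [hneg, hgb]) (by rw [hper, hfa]) hfc
    (by linarith) (by linarith) (by linarith) (by linarith)
  have t1 := im_sub_im_of_exp_eq_sub (θ := d) (β := a + 2 * Real.pi) (δ := c + 2 * Real.pi)
    (L := fun s => L (s, 1) + Real.pi * I)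
    (h := f) (by fun_prop) hf1 (fun t => by rw [hneg, hgd]) (by rw [hper, hfa]) (by rw [hper, hfc])
    (by linarith) (by linarith) (by linarith) (by linarith)
  simp only [add_im] at t0 t1
  have := Real.pi_pos
  linarith

theorem Complex.nonempty_inter_of_interleaving {a b c d : ℝ} (hab : a < b) (hbc : b < c)
    (hcd : c < d) (hda : d < a + 2 * Real.pi) {K K' : Set ℂ}
    (hK : K ⊆ Metric.closedBall 0 1) (hK' : K' ⊆ Metric.closedBall 0 1)
    (h : JoinedIn K (exp (a * I)) (exp (c * I))) (h' : JoinedIn K' (exp (b * I)) (exp (d * I))) :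
    (K ∩ K').Nonempty := by
  have hmem : ∀ {K : Set ℂ} {x y : ℂ} (h : JoinedIn K x y) (t : ℝ), h.somePath.extend t ∈ K := by
    intro K x y h t
    obtain ⟨u, hu⟩ : h.somePath.extend t ∈ Set.range h.somePath := by
      rw [← Path.extend_range]
      exact Set.mem_range_self t
    exact hu ▸ h.somePath_mem u
  obtain ⟨s, t, hst⟩ := Complex.exists_eq_of_interleaving hab hbc hcd hda
    h.somePath.continuous_extend h'.somePath.continuous_extend
    (fun t => by simpa using hK (hmem h t)) (fun t => by simpa using hK' (hmem h' t))
    h.somePath.extend_zero h.somePath.extend_one h'.somePath.extend_zero h'.somePath.extend_one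
  exact ⟨_, hmem h s, hst ▸ hmem h' t⟩

end Crossing

/-! ### Walks inside a vertex set and Menger's theorem. -/

namespace SimpleGraph

variable {V : Type*} {G H : SimpleGraph V} {P Q : Set V} {a b c : V}

/-- `b` can be reached from `a` in `G` by a walk all of whose vertices lie in `P`. -/
def ReachIn (G : SimpleGraph V) (P : Set V) (a b : V) : Prop :=
  a ∈ P ∧ Relation.ReflTransGen (fun u v => G.Adj u v ∧ u ∈ P ∧ v ∈ P) a b

theorem ReachIn.refl (h : a ∈ P) : G.ReachIn P a a := ⟨h, .refl⟩

theorem ReachIn.trans (h : G.ReachIn P a b) (h' : G.ReachIn P b c) : G.ReachIn P a c :=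
  ⟨h.1, h.2.trans h'.2⟩

theorem ReachIn.mem_right (h : G.ReachIn P a b) : b ∈ P := by
  rcases h.2.cases_tail with rfl | ⟨c, -, hc⟩
  exacts [h.1, hc.2.2]

theorem ReachIn.tail (h : G.ReachIn P a b) (hbc : G.Adj b c) (hc : c ∈ P) : G.ReachIn P a c :=
  ⟨h.1, h.2.tail ⟨hbc, h.mem_right, hc⟩⟩

theorem ReachIn.symm (h : G.ReachIn P a b) : G.ReachIn P b a :=
  ⟨h.mem_right, by
  have : Std.Symm (fun u v => G.Adj u v ∧ u ∈ P ∧ v ∈ P) := ⟨fun _ _ h => ⟨h.1.symm, h.2.2, h.2.1⟩⟩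
  exact Relation.ReflTransGen.stdSymm.symm _ _ h.2⟩

@[elab_as_elim]
theorem ReachIn.induction {p : V → Prop} (h : G.ReachIn P a b) (h0 : p a)
    (hs : ∀ u v, G.ReachIn P a u → G.Adj u v → v ∈ P → p u → p v) : p b := by
  obtain ⟨ha, h⟩ := h
  induction h with
  | refl => exact h0
  | tail hab hbc ih => exact hs _ _ ⟨ha, hab⟩ hbc.1 hbc.2.2 ih

theorem ReachIn.mono (h : G.ReachIn P a b) (hG : G ≤ H) (hP : P ⊆ Q) : H.ReachIn Q a b :=
  h.induction (.refl (hP h.1)) fun _ _ _ huv hv ih => ih.tail (hG huv) (hP hv)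

theorem ReachIn.reachIn_setOf (h : G.ReachIn P a b) : G.ReachIn {w | G.ReachIn P a w} a b :=
  h.induction (.refl (.refl h.1)) fun _ _ hu huv hv ih => ih.tail huv (hu.tail huv hv)

theorem ReachIn.connected_induce (h : a ∈ P) (hP : ∀ b ∈ P, G.ReachIn P a b) :
    (G.induce P).Connected := by
  rw [connected_iff_exists_forall_reachable]
  refine ⟨⟨a, h⟩, ?_⟩
  rintro ⟨b, hb⟩
  have : ∃ hb : b ∈ P, (G.induce P).Reachable ⟨a, h⟩ ⟨b, hb⟩ := by
    refine (hP b hb).induction ⟨h, .refl _⟩ ?_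
    rintro u v - huv hv ⟨hu, ih⟩
    exact ⟨hv, ih.trans (Adj.reachable (by simpa using huv))⟩
  exact this.2

theorem ReachIn.connected_induce_setOf (h : a ∈ P) :
    (G.induce {w | G.ReachIn P a w}).Connected :=
  ReachIn.connected_induce (a := a) (.refl h) fun _ hb => hb.reachIn_setOf

theorem Connected.reachIn (h : (G.induce P).Connected) (ha : a ∈ P) (hb : b ∈ P) :
    G.ReachIn P a b := by
  obtain ⟨w⟩ := h.preconnected ⟨a, ha⟩ ⟨b, hb⟩
  suffices ∀ u v : P, (G.induce P).Walk u v → G.ReachIn P u v from this _ _ w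
  intro u v w
  induction w with
  | nil => exact .refl (Subtype.coe_prop _)
  | @cons u v w huv _ ih =>
    exact (ReachIn.tail (.refl u.2) (by simpa using huv) v.2).trans ih

/-- A walk either avoids `Y`, or has an initial part that meets `Y` in its last vertex only. -/
theorem ReachIn.avoid_or_first_hit {Y : Set V} (h : G.ReachIn P a b)
    (hGH : ∀ u v, H.ReachIn (P \ Y) a u → G.Adj u v → H.Adj u v) :
    H.ReachIn (P \ Y) a b ∨
      ∃ y ∈ Y, y ∈ P ∧ H.ReachIn (insert y {w | H.ReachIn (P \ Y) a w}) a y := by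
  refine h.induction ?_ ?_
  · by_cases ha : a ∈ Y
    · exact .inr ⟨a, ha, h.1, .refl (Set.mem_insert _ _)⟩
    · exact .inl (.refl ⟨h.1, ha⟩)
  · rintro u v - huv hv (ih | ih)
    · have huv' := hGH u v ih huv
      by_cases hvY : v ∈ Y
      · exact .inr ⟨v, hvY, hv, (ih.reachIn_setOf.mono le_rfl (Set.subset_insert _ _)).tail huv'
          (Set.mem_insert _ _)⟩
      · exact .inl (ih.tail huv' ⟨hv, hvY⟩)
    · exact .inr ih

/-- The set `X` separates `A` from `B`. -/
def Separates (G : SimpleGraph V) (X A B : Set V) : Prop :=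
  ∀ a ∈ A, ∀ b ∈ B, ¬ G.ReachIn Xᶜ a b

theorem Separates.symm {X A B : Set V} (h : G.Separates X A B) : G.Separates X B A :=
  fun b hb a ha hab => h a ha b hb hab.symm

/-- There are `k` disjoint sets of vertices that each contain a walk from `A` to `B`. -/
def HasDisjointPaths (G : SimpleGraph V) (k : ℕ) (A B : Set V) : Prop :=
  ∃ P : Fin k → Set V, (∀ i j, i ≠ j → Disjoint (P i) (P j)) ∧
    ∀ i, ∃ a ∈ A, ∃ b ∈ B, G.ReachIn (P i) a b

theorem HasDisjointPaths.mono {k : ℕ} {A B : Set V} (h : H.HasDisjointPaths k A B) (hHG : H ≤ G) :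
    G.HasDisjointPaths k A B := by
  obtain ⟨P, hd, hP⟩ := h
  refine ⟨P, hd, fun i => ?_⟩
  obtain ⟨a, ha, b, hb, hab⟩ := hP i
  exact ⟨a, ha, b, hb, hab.mono hHG subset_rfl⟩

/-- Cut every path at its first vertex in `Y`; as `Y` has at most `k` elements, each of them ends
exactly one path. Apart from its end, a path then stays on the `A`-side of `Y`, which later keeps it
apart from paths on the `B`-side. -/
theorem HasDisjointPaths.exists_linkage {k : ℕ} {A : Set V} {Y : Finset V}
    (h : G.HasDisjointPaths k A Y) (hY : Y.card ≤ k) :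
    Y.card = k ∧ ∃ P : V → Set V, (∀ y ∈ Y, ∀ z ∈ Y, y ≠ z → Disjoint (P y) (P z)) ∧
      ∀ y ∈ Y, (∃ a ∈ A, G.ReachIn (P y) a y) ∧
        ∀ w ∈ P y, w = y ∨ ∃ a ∈ A, G.ReachIn (Y : Set V)ᶜ a w := by
  classical
  obtain ⟨P, hd, hP⟩ := h
  have key : ∀ i, ∃ y ∈ Y, y ∈ P i ∧ ∃ a ∈ A, a ∈ P i ∧
      G.ReachIn (insert y {w | G.ReachIn (P i \ Y) a w}) a y := by
    intro i
    obtain ⟨a, ha, b, hb, hab⟩ := hP i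
    rcases hab.avoid_or_first_hit (H := G) (Y := Y) (fun _ _ _ h => h) with h | ⟨y, hy, hyP, h⟩
    · exact absurd hb h.mem_right.2
    · exact ⟨y, hy, hyP, a, ha, hab.1, h⟩
  choose y hyY hyP a haA haP hr using key
  have hinj : Function.Injective y := by
    intro i j hij
    by_contra hne
    exact Set.disjoint_left.1 (hd i j hne) (hyP i) (hij ▸ hyP j)
  have himg : Finset.univ.image y = Y := by
    apply Finset.eq_of_subset_of_card_le
    · intro z hz
      obtain ⟨i, -, rfl⟩ := Finset.mem_image.1 hz
      exact hyY i
    · rw [Finset.card_image_of_injective _ hinj]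
      simpa using hY
  refine ⟨by rw [← himg, Finset.card_image_of_injective _ hinj]; simp, ?_⟩
  refine ⟨fun z => {w | ∃ i, y i = z ∧ w ∈ insert (y i) {w | G.ReachIn (P i \ Y) (a i) w}}, ?_, ?_⟩
  · rintro z - z' - hne
    rw [Set.disjoint_left]
    rintro w ⟨i, rfl, hi⟩ ⟨j, rfl, hj⟩
    have hsub : ∀ i, w ∈ insert (y i) {w | G.ReachIn (P i \ Y) (a i) w} → w ∈ P i := by
      rintro i (rfl | h)
      exacts [hyP i, h.mem_right.1]
    exact Set.disjoint_left.1 (hd i j fun h => hne (by rw [h])) (hsub i hi) (hsub j hj)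
  · intro z hz
    rw [← himg] at hz
    obtain ⟨i, -, rfl⟩ := Finset.mem_image.1 hz
    refine ⟨⟨a i, haA i, (hr i).mono le_rfl fun w hw => ⟨i, rfl, hw⟩⟩, ?_⟩
    rintro w ⟨j, hj, hw⟩
    obtain rfl := hinj hj
    rcases hw with rfl | hw
    · exact .inl rfl
    · exact .inr ⟨a j, haA j, ReachIn.mono hw le_rfl fun _ h => h.2⟩

/-- Until a walk from `A` hits `S ∪ {p}` it cannot use the edge `pq`: it has not visited `p`, and
`q` lies on the `B`-side of `S`. So it is a walk of the smaller graph, and it must hit `S ∪ {p}` to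
get to `B`. -/
theorem Separates.of_deleteEdges {A B : Set V} {S Z : Finset V} {p q : V}
    (hS : (G.deleteEdges {s(p, q)}).Separates S A B)
    (hq : ∃ b ∈ B, (G.deleteEdges {s(p, q)}).ReachIn (S : Set V)ᶜ b q)
    (hZ : (G.deleteEdges {s(p, q)}).Separates Z A (insert p (S : Set V))) :
    G.Separates Z A B := by
  intro a ha b hb hab
  have hstep : ∀ u v, (G.deleteEdges {s(p, q)}).ReachIn ((Z : Set V)ᶜ \ insert p (S : Set V)) a u →
      G.Adj u v → (G.deleteEdges {s(p, q)}).Adj u v := by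
    intro u v hu huv
    refine (deleteEdges_adj).2 ⟨huv, ?_⟩
    rw [Set.mem_singleton_iff, Sym2.eq_iff]
    rintro (⟨rfl, -⟩ | ⟨rfl, -⟩)
    · exact hu.mem_right.2 (Set.mem_insert _ _)
    · obtain ⟨b, hb, hbq⟩ := hq
      exact hS a ha b hb ((hu.mono le_rfl fun w hw hwS =>
        hw.2 (Set.mem_insert_of_mem _ hwS)).trans hbq.symm)
  rcases hab.avoid_or_first_hit hstep with h | ⟨y, hy, hyP, h⟩
  · exact hS a ha b hb (h.mono le_rfl fun w hw hwS => hw.2 (Set.mem_insert_of_mem _ hwS))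
  · refine hZ a ha y hy (h.mono le_rfl ?_)
    rintro w (rfl | hw)
    exacts [hyP, hw.mem_right.1]

/-- **Menger's theorem**, for sets of vertices of a finite graph. -/
theorem hasDisjointPaths_of_forall_separates [Finite V] (G : SimpleGraph V) (A B : Set V) (k : ℕ)
    (h : ∀ X : Finset V, G.Separates X A B → k ≤ X.card) : G.HasDisjointPaths k A B := by
  classical
  have := Fintype.ofFinite V
  induction G using WellFoundedLT.induction generalizing A B with
  | ind G ih =>
  by_cases hbot : G = ⊥
  · subst hbot
    -- Without edges, `A ∩ B` itself is a separator and its vertices are the paths.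
    have hk : k ≤ (A ∩ B).toFinset.card := by
      apply h
      intro a ha b hb hab
      have hba : b = a := hab.induction rfl fun u v _ huv _ _ => absurd huv (by simp)
      subst hba
      exact hab.1 (by simpa using ⟨ha, hb⟩)
    obtain ⟨T, hT, hTk⟩ := Finset.exists_subset_card_eq hk
    refine ⟨fun i => {((Finset.equivFinOfCardEq hTk).symm i).1}, ?_, fun i => ?_⟩
    · intro i j hij
      rw [Set.disjoint_singleton]
      intro h
      exact hij ((Finset.equivFinOfCardEq hTk).symm.injective (Subtype.ext h))
    · have := hT ((Finset.equivFinOfCardEq hTk).symm i).2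
      rw [Set.mem_toFinset] at this
      exact ⟨_, this.1, _, this.2, .refl rfl⟩
  obtain ⟨x, y, hxy⟩ := ne_bot_iff_exists_adj.1 hbot
  have hlt : ∀ {p q}, G.Adj p q → G.deleteEdges {s(p, q)} < G := by
    intro p q hpq
    refine lt_of_le_of_ne (deleteEdges_le _) fun he => ?_
    rw [← he] at hpq
    simp at hpq
  by_cases hH : ∀ X : Finset V, (G.deleteEdges {s(x, y)}).Separates X A B → k ≤ X.card
  · exact (ih _ (hlt hxy) A B hH).mono (deleteEdges_le _)
  push Not at hH
  obtain ⟨S, hS, hSk⟩ := hH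
  -- `S` has fewer than `k` elements, so it does not separate in `G`; a walk avoiding `S` must use
  -- the deleted edge, and its initial part reaches an end of that edge.
  have hend : ∀ A B : Set V, (G.deleteEdges {s(x, y)}).Separates S A B →
      (¬ G.Separates S A B) →
      (∃ a ∈ A, (G.deleteEdges {s(x, y)}).ReachIn (S : Set V)ᶜ a x) ∨
      (∃ a ∈ A, (G.deleteEdges {s(x, y)}).ReachIn (S : Set V)ᶜ a y) := by
    intro A B hS hG
    simp only [Separates] at hG
    push Not at hG
    obtain ⟨a, ha, b, hb, hab⟩ := hG
    have hstep : ∀ u v, (G.deleteEdges {s(x, y)}).ReachIn ((S : Set V)ᶜ \ {x, y}) a u →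
        G.Adj u v → (G.deleteEdges {s(x, y)}).Adj u v := by
      intro u v hu huv
      refine (deleteEdges_adj).2 ⟨huv, ?_⟩
      rw [Set.mem_singleton_iff, Sym2.eq_iff]
      rintro (⟨rfl, -⟩ | ⟨rfl, -⟩) <;> exact hu.mem_right.2 (by simp)
    rcases hab.avoid_or_first_hit hstep with h | ⟨z, hz, hzP, h⟩
    · exact absurd (h.mono le_rfl Set.sdiff_subset) (hS a ha b hb)
    · have h' : (G.deleteEdges {s(x, y)}).ReachIn (S : Set V)ᶜ a z := by
        refine h.mono le_rfl ?_
        rintro w (rfl | hw)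
        exacts [hzP, hw.mem_right.1]
      rcases hz with rfl | rfl
      · exact .inl ⟨a, ha, h'⟩
      · exact .inr ⟨a, ha, h'⟩
  have hnG : ¬ G.Separates S A B := fun h' => absurd (h S h') (by omega)
  have hnG' : ¬ G.Separates S B A := fun h' => hnG h'.symm
  have hAB : ∀ z, (∃ a ∈ A, (G.deleteEdges {s(x, y)}).ReachIn (S : Set V)ᶜ a z) →
      ¬ ∃ b ∈ B, (G.deleteEdges {s(x, y)}).ReachIn (S : Set V)ᶜ b z := by
    rintro z ⟨a, ha, haz⟩ ⟨b, hb, hbz⟩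
    exact hS a ha b hb (haz.trans hbz.symm)
  obtain ⟨p, q, hpq, hp, hq, hpq'⟩ : ∃ p q, s(x, y) = s(p, q) ∧
      (∃ a ∈ A, (G.deleteEdges {s(x, y)}).ReachIn (S : Set V)ᶜ a p) ∧
      (∃ b ∈ B, (G.deleteEdges {s(x, y)}).ReachIn (S : Set V)ᶜ b q) ∧ G.Adj p q := by
    rcases hend A B hS hnG with h1 | h1 <;> rcases hend B A hS.symm hnG' with h2 | h2
    · exact absurd h2 (hAB _ h1)
    · exact ⟨x, y, rfl, h1, h2, hxy⟩
    · exact ⟨y, x, Sym2.eq_swap, h1, h2, hxy.symm⟩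
    · exact absurd h2 (hAB _ h1)
  rw [hpq] at hS hp hq hAB
  have hcard : ∀ z, (insert z S).card ≤ k := fun z => (Finset.card_insert_le _ _).trans hSk
  have hpS : p ∉ S := by obtain ⟨a, -, ha⟩ := hp; exact fun h => ha.mem_right h
  have hqS : q ∉ S := by obtain ⟨a, -, ha⟩ := hq; exact fun h => ha.mem_right h
  obtain ⟨hck, P, hPd, hP⟩ := (ih _ (hlt hpq') A (insert p S : Finset V) fun Z hZ =>
    h Z (Separates.of_deleteEdges hS hq (by simpa using hZ))).exists_linkage (hcard p)
  obtain ⟨-, Q, hQd, hQ⟩ := (ih _ (hlt hpq') B (insert q S : Finset V) fun Z hZ => by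
    refine h Z (Separates.symm (Separates.of_deleteEdges (p := q) (q := p) (S := S) ?_ ?_ ?_))
    · rw [Sym2.eq_swap]; exact hS.symm
    · rw [Sym2.eq_swap]; exact hp
    · rw [Sym2.eq_swap]; simpa using hZ).exists_linkage (hcard q)
  have hle := G.deleteEdges_le {s(p, q)}
  have hPA : ∀ z ∈ insert p S, ∀ w ∈ P z, w = z ∨
      ∃ a ∈ A, (G.deleteEdges {s(p, q)}).ReachIn (S : Set V)ᶜ a w := by
    intro z hz w hw
    refine ((hP z hz).2 w hw).imp id ?_
    rintro ⟨a, ha, haw⟩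
    exact ⟨a, ha, haw.mono le_rfl fun v hv hvS => hv (Finset.mem_insert_of_mem hvS)⟩
  have hQB : ∀ z ∈ insert q S, ∀ w ∈ Q z, w = z ∨
      ∃ a ∈ B, (G.deleteEdges {s(p, q)}).ReachIn (S : Set V)ᶜ a w := by
    intro z hz w hw
    refine ((hQ z hz).2 w hw).imp id ?_
    rintro ⟨a, ha, haw⟩
    exact ⟨a, ha, haw.mono le_rfl fun v hv hvS => hv (Finset.mem_insert_of_mem hvS)⟩
  have hnS : ∀ (C : Set V) w, w ∈ S →
      ¬ ∃ a ∈ C, (G.deleteEdges {s(p, q)}).ReachIn (S : Set V)ᶜ a w :=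
    fun C w hw ⟨a, _, h⟩ => h.mem_right hw
  -- The path from `A` ending in `z ∈ S` continues with the path to `B` from `z`; the one ending in
  -- `p` crosses the edge `pq` and continues from `q`.
  let τ : V → V := fun z => if z = p then q else z
  have hτ : ∀ z ∈ insert p S, τ z ∈ insert q S := by
    intro z hz
    simp only [τ]
    split_ifs with h
    · exact Finset.mem_insert_self _ _
    · exact Finset.mem_insert_of_mem (Finset.mem_of_mem_insert_of_ne hz h)
  have hτi : ∀ z ∈ insert p S, ∀ w ∈ insert p S, z ≠ w → τ z ≠ τ w := by
    intro z hz w hw hne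
    simp only [τ]
    split_ifs with h1 h2 h2
    · exact absurd (h1.trans h2.symm) hne
    · exact fun h => hqS (h ▸ Finset.mem_of_mem_insert_of_ne hw h2)
    · exact fun h => hqS (h ▸ Finset.mem_of_mem_insert_of_ne hz h1)
    · exact hne
  -- A common vertex would be reachable from both `A` and `B` off `S`, or would be in `S` and then
  -- the end of both paths.
  have hcross : ∀ z ∈ insert p S, ∀ w ∈ insert p S, z ≠ w → Disjoint (P z) (Q (τ w)) := by
    intro z hz w hw hne
    rw [Set.disjoint_left]
    intro v hv hv'
    have h1 : v = z ∧ z ∈ S ∨ ∃ a ∈ A, (G.deleteEdges {s(p, q)}).ReachIn (S : Set V)ᶜ a v := by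
      rcases hPA z hz v hv with rfl | h
      · rcases Finset.mem_insert.1 hz with rfl | hz
        · exact .inr hp
        · exact .inl ⟨rfl, hz⟩
      · exact .inr h
    have h2 : v = w ∧ w ∈ S ∨ ∃ a ∈ B, (G.deleteEdges {s(p, q)}).ReachIn (S : Set V)ᶜ a v := by
      rcases hQB _ (hτ w hw) v hv' with h | h
      · by_cases hwp : w = p
        · simp only [τ, if_pos hwp] at h
          exact .inr (h ▸ hq)
        · simp only [τ, if_neg hwp] at h
          exact .inl ⟨h, Finset.mem_of_mem_insert_of_ne hw hwp⟩
      · exact .inr h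
    rcases h1 with ⟨rfl, h1⟩ | h1 <;> rcases h2 with ⟨rfl, h2⟩ | h2
    · exact hne rfl
    · exact hnS _ _ h1 h2
    · exact hnS _ _ h2 h1
    · exact hAB _ h1 h2
  let e := (Finset.equivFinOfCardEq hck).symm
  refine ⟨fun i => P (e i) ∪ Q (τ (e i)), ?_, ?_⟩
  · intro i j hij
    have hne : (e i : V) ≠ e j := fun h => hij (e.injective (Subtype.ext h))
    rw [Set.disjoint_union_left, Set.disjoint_union_right, Set.disjoint_union_right]
    exact ⟨⟨hPd _ (e i).2 _ (e j).2 hne, hcross _ (e i).2 _ (e j).2 hne⟩,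
      (hcross _ (e j).2 _ (e i).2 hne.symm).symm,
      hQd _ (hτ _ (e i).2) _ (hτ _ (e j).2) (hτi _ (e i).2 _ (e j).2 hne)⟩
  · intro i
    obtain ⟨a, ha, haz⟩ := (hP _ (e i).2).1
    obtain ⟨b, hb, hbz⟩ := (hQ _ (hτ _ (e i).2)).1
    have h1 := haz.mono hle (Set.subset_union_left (t := Q (τ (e i))))
    have h2 := hbz.mono hle (Set.subset_union_right (s := P (e i)))
    refine ⟨a, ha, b, hb, h1.trans (ReachIn.trans ?_ h2.symm)⟩
    by_cases hp : (e i : V) = p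
    · refine ReachIn.tail (.refl h1.mem_right) ?_ h2.mem_right
      simpa [τ, hp] using hpq'
    · have : τ (e i) = e i := by simp [τ, hp]
      rw [this] at h1 h2 ⊢
      exact .refl h1.mem_right

end SimpleGraph

/-! ### Tree-decompositions from balanced separators. -/

namespace SimpleGraph

variable {V : Type*} {G : SimpleGraph V}

/-- The tree obtained from `T` by attaching a new leaf to `y`. -/
def attachLeaf {N : Type*} (T : SimpleGraph N) (y : N) : SimpleGraph (Option N) :=
  T.map Function.Embedding.some ⊔ edge none (some y)

section AttachLeaf

variable {N : Type*} {T : SimpleGraph N} {y : N}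

theorem attachLeaf_adj_some {a b : N} (h : T.Adj a b) :
    (T.attachLeaf y).Adj (some a) (some b) :=
  Or.inl ((map_adj _ _ _ _).2 ⟨a, b, h, rfl, rfl⟩)

theorem attachLeaf_adj_none : (T.attachLeaf y).Adj none (some y) :=
  Or.inr (by simp [edge_adj])

theorem ReachIn.attachLeaf {P : Set N} {P' : Set (Option N)} {a b : N} (h : T.ReachIn P a b)
    (hP : ∀ x ∈ P, some x ∈ P') : (T.attachLeaf y).ReachIn P' (some a) (some b) :=
  h.induction (.refl (hP _ h.1)) fun _ _ _ huv hv ih => ih.tail (attachLeaf_adj_some huv) (hP _ hv)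

theorem IsTree.attachLeaf [Finite N] (hT : T.IsTree) : (T.attachLeaf y).IsTree := by
  have := Fintype.ofFinite N
  rw [isTree_iff_connected_and_card] at hT ⊢
  obtain ⟨hc, hcard⟩ := hT
  constructor
  · rw [connected_iff_exists_forall_reachable]
    refine ⟨some y, ?_⟩
    rintro (_ | b)
    · exact attachLeaf_adj_none.symm.reachable
    · exact (hc.preconnected y b).map ⟨some, attachLeaf_adj_some⟩
  · have hE : (T.attachLeaf y).edgeSet =
        insert s(none, some y) (Function.Embedding.some.sym2Map '' T.edgeSet) := by
      rw [SimpleGraph.attachLeaf, edgeSet_sup, edgeSet_map, edgeSet_edge_of_ne (by simp)]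
      exact Set.union_singleton
    rw [hE, Nat.card_coe_set_eq, Set.ncard_insert_of_notMem, Set.ncard_image_of_injective _
      (Function.Embedding.injective _), ← Nat.card_coe_set_eq, hcard]
    · simp
    · rintro ⟨e, -, he⟩
      induction e with
      | h a b => simp at he

end AttachLeaf

/-- There is a tree-decomposition of the subgraph induced by `U` with bags of size at most `w`,
and each member of `𝓑` is contained in a bag. -/
def Decomposable (G : SimpleGraph V) (w : ℕ) (U : Finset V) (𝓑 : Set (Finset V)) : Prop :=
  ∃ (N : Type) (_ : Fintype N) (T : SimpleGraph N) (bag : N → Finset V), T.IsTree ∧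
    (∀ x, bag x ⊆ U) ∧ (∀ x, (bag x).card ≤ w) ∧
    (∀ u ∈ U, ∀ v ∈ U, G.Adj u v → ∃ x, u ∈ bag x ∧ v ∈ bag x) ∧
    (∀ v ∈ U, (T.induce {x | v ∈ bag x}).Connected) ∧ ∀ B ∈ 𝓑, ∃ x, B ⊆ bag x

theorem Decomposable.mono {w : ℕ} {U : Finset V} {𝓑 𝓑' : Set (Finset V)}
    (h : G.Decomposable w U 𝓑) (hB : 𝓑' ⊆ 𝓑) : G.Decomposable w U 𝓑' := by
  obtain ⟨N, hN, T, bag, h1, h2, h3, h4, h5, h6⟩ := h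
  exact ⟨N, hN, T, bag, h1, h2, h3, h4, h5, fun B hB' => h6 B (hB hB')⟩

theorem decomposable_empty (w : ℕ) : G.Decomposable w ∅ {∅} :=
  ⟨Unit, inferInstance, ⊥, fun _ => ∅, IsTree.of_subsingleton, by simp, by simp, by simp, by simp,
    by simp⟩

/-- The new bag `N` becomes a leaf at a node whose bag contains `B`. All old vertices of `N` are in
that bag, so the nodes of each vertex stay connected. -/
theorem Decomposable.union_bag [DecidableEq V] {w : ℕ} {U N B : Finset V} {𝓑 : Set (Finset V)}
    (h : G.Decomposable w U 𝓑) (hB : B ∈ 𝓑) (hN : N ∩ U ⊆ B) (hw : N.card ≤ w)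
    (hadj : ∀ a ∈ N, a ∉ U → ∀ b ∈ U, b ∉ N → ¬ G.Adj a b) :
    G.Decomposable w (U ∪ N) (insert N 𝓑) := by
  obtain ⟨M, hM, T, bag, hT, hU, hbw, hedge, hconn, h𝓑⟩ := h
  obtain ⟨y, hy⟩ := h𝓑 B hB
  refine ⟨Option M, inferInstance, T.attachLeaf y, fun x => x.elim N bag, hT.attachLeaf,
    ?_, ?_, ?_, ?_, ?_⟩
  · rintro (_ | x)
    · exact Finset.subset_union_right
    · exact (hU x).trans Finset.subset_union_left
  · rintro (_ | x)
    · exact hw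
    · exact hbw x
  · intro u hu v hv huv
    by_cases huN : u ∈ N
    · by_cases hvN : v ∈ N
      · exact ⟨none, huN, hvN⟩
      · have hvU : v ∈ U := (Finset.mem_union.1 hv).resolve_right hvN
        by_cases huU : u ∈ U
        · obtain ⟨x, hx⟩ := hedge u huU v hvU huv
          exact ⟨some x, hx⟩
        · exact absurd huv (hadj u huN huU v hvU hvN)
    · have huU : u ∈ U := (Finset.mem_union.1 hu).resolve_right huN
      by_cases hvU : v ∈ U
      · obtain ⟨x, hx⟩ := hedge u huU v hvU huv
        exact ⟨some x, hx⟩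
      · exact absurd huv.symm (hadj v ((Finset.mem_union.1 hv).resolve_left hvU) hvU u huU huN)
  · intro v hv
    by_cases hvN : v ∈ N
    · have hnone : (none : Option M) ∈ {x : Option M | v ∈ x.elim N bag} := hvN
      refine ReachIn.connected_induce hnone ?_
      rintro (_ | b) hb
      · exact .refl hnone
      · have hvU : v ∈ U := hU b hb
        have hvy : v ∈ bag y := hy (hN (Finset.mem_inter.2 ⟨hvN, hvU⟩))
        refine (ReachIn.tail (.refl hnone) attachLeaf_adj_none hvy).trans
          (ReachIn.attachLeaf ((hconn v hvU).reachIn hvy hb) fun x hx => hx)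
    · have hvU : v ∈ U := (Finset.mem_union.1 hv).resolve_right hvN
      obtain ⟨⟨a, ha⟩⟩ := (hconn v hvU).nonempty
      refine ReachIn.connected_induce (a := some a) ha ?_
      rintro (_ | b) hb
      · exact absurd hb hvN
      · exact ReachIn.attachLeaf ((hconn v hvU).reachIn ha hb) fun x hx => hx
  · rintro B' (rfl | hB')
    · exact ⟨none, subset_rfl⟩
    · obtain ⟨x, hx⟩ := h𝓑 B' hB'
      exact ⟨some x, hx⟩

/-- Every `s`-set `S` can be broken up by deleting at most `x` vertices. -/
def HasSeparators (G : SimpleGraph V) (s x : ℕ) : Prop :=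
  ∀ S : Finset V, S.card = s → ∃ X : Finset V, X.card ≤ x ∧
    ∀ C : Finset V, (∃ v ∉ X, (C : Set V) = {u | G.ReachIn (X : Set V)ᶜ v u}) →
      ∀ D ⊆ S, D ⊆ C → D.card + X.card < s

/-- The part `U` is glued to a decomposition of `U₀` along the interface `S`, which lies in a bag.
If `U` is large, separate a superset `S'` of `S` with exactly `s` elements by `X`, add the bag `S' ∪
(X ∩ U)`, and glue on `U ∩ (C ∪ X)` for each component `C` of `G - X`, with interface `(S' ∩ C) ∪ (X
∩ U)`. The separator bound keeps that interface within size `s`. -/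
theorem HasSeparators.decomposable_union [Finite V] [DecidableEq V] {s x : ℕ}
    (h : G.HasSeparators s x) (n : ℕ) (U S : Finset V) (hn : U.card = n) (hSU : S ⊆ U)
    (hSs : S.card ≤ s) (U₀ : Finset V) (𝓑 : Set (Finset V))
    (hD : G.Decomposable (s + x) U₀ 𝓑) (hSB : ∃ B ∈ 𝓑, S ⊆ B) (hSU₀ : S ⊆ U₀) (hUU : U ∩ U₀ ⊆ S)
    (hadj : ∀ a ∈ U, a ∉ S → ∀ b ∈ U₀, b ∉ S → ¬ G.Adj a b) :
    G.Decomposable (s + x) (U₀ ∪ U) 𝓑 := by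
  classical
  have := Fintype.ofFinite V
  induction n using Nat.strong_induction_on generalizing U S U₀ 𝓑 with
  | _ n ih =>
  have hleaf : ∀ N : Finset V, S ⊆ N → N ⊆ U → N.card ≤ s + x →
      G.Decomposable (s + x) (U₀ ∪ N) (insert N 𝓑) := by
    intro N hSN hNU hN
    obtain ⟨B, hB, hSB⟩ := hSB
    refine hD.union_bag hB ?_ hN ?_
    · exact (Finset.inter_subset_inter_right hNU).trans (hUU.trans hSB)
    · intro a ha haU b hb hbN
      exact hadj a (hNU ha) (fun h => haU (hSU₀ h)) b hb (fun h => hbN (hSN h))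
  by_cases hcard : U.card ≤ s + x
  · exact (hleaf U hSU subset_rfl hcard).mono (Set.subset_insert _ _)
  obtain ⟨S', hSS', hS'U, hS's⟩ := Finset.exists_subsuperset_card_eq hSU hSs (by omega)
  obtain ⟨X, hX, hXC⟩ := h S' hS's
  have hN := hleaf (S' ∪ X ∩ U) (hSS'.trans Finset.subset_union_left)
    (Finset.union_subset hS'U Finset.inter_subset_right)
    ((Finset.card_union_le _ _).trans (by
      have := Finset.card_le_card (Finset.inter_subset_left (s₁ := X) (s₂ := U))
      omega))
  set N := S' ∪ X ∩ U with hNdef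
  let comp : V → Finset V := fun v => Finset.univ.filter fun u => G.ReachIn (X : Set V)ᶜ v u
  have hcomp : ∀ u v, u ∈ comp v ↔ G.ReachIn (X : Set V)ᶜ v u := by simp [comp]
  let 𝒞 : Finset (Finset V) := (Finset.univ.filter fun v => v ∉ X).image comp
  -- The components are added one at a time; recording `N` among the available bags lets each of
  -- them attach there.
  have hiter : ∀ 𝒟 ⊆ 𝒞, G.Decomposable (s + x) (U₀ ∪ N ∪ 𝒟.biUnion fun C => U ∩ C)
      (insert N 𝓑) := by
    intro 𝒟
    induction 𝒟 using Finset.induction_on with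
    | empty => intro _; simpa using hN
    | insert C 𝒟 hC𝒟 ih𝒟 =>
      intro hsub
      have hprev := ih𝒟 ((Finset.subset_insert _ _).trans hsub)
      have hC𝒞 : C ∈ 𝒞 := hsub (Finset.mem_insert_self _ _)
      obtain ⟨v, hvX, rfl⟩ : ∃ v ∉ X, comp v = C := by simpa [𝒞] using hC𝒞
      have hcount := hXC (comp v) ⟨v, hvX, by ext u; simp [hcomp]⟩ (S' ∩ comp v)
        Finset.inter_subset_left Finset.inter_subset_right
      have hCX : ∀ u ∈ comp v, u ∉ X := fun u hu => by
        have := ((hcomp _ _).1 hu).mem_right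
        simpa using this
      have hclosed : ∀ a ∈ comp v, ∀ b, G.Adj a b → b ∉ X → b ∈ comp v := by
        intro a ha b hab hb
        rw [hcomp] at ha ⊢
        exact ha.tail hab (by simpa using hb)
      have hdisj : ∀ C' ∈ 𝒟, ∀ u ∈ comp v, u ∉ C' := by
        intro C' hC' u hu hu'
        obtain ⟨v', hv', rfl⟩ : ∃ v ∉ X, comp v = C' := by
          simpa [𝒞] using hsub (Finset.mem_insert_of_mem hC')
        refine hC𝒟 ?_
        convert! hC' using 1
        ext z
        rw [hcomp] at hu hu'
        rw [hcomp, hcomp]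
        exact ⟨fun hz => hu'.trans (hu.symm.trans hz), fun hz => hu.trans (hu'.symm.trans hz)⟩
      have hset : U₀ ∪ N ∪ (insert (comp v) 𝒟).biUnion (fun C => U ∩ C) =
          (U₀ ∪ N ∪ 𝒟.biUnion fun C => U ∩ C) ∪ (U ∩ (comp v ∪ X)) := by
        rw [Finset.biUnion_insert]
        ext z
        simp only [Finset.mem_union, Finset.mem_inter, hNdef]
        tauto
      rw [hset]
      refine ih _ ?_ (U ∩ (comp v ∪ X)) ((S' ∩ comp v) ∪ (X ∩ U)) rfl ?_ ?_ _ _ hprev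
        ⟨N, Set.mem_insert _ _, ?_⟩ ?_ ?_ ?_
      · rw [← hn]
        apply Finset.card_lt_card
        refine ⟨Finset.inter_subset_left, fun hle => ?_⟩
        -- If the new part were all of `U`, then `S'` would be covered by `S' ∩ C` and `X`, which
        -- together have fewer than `s` elements.
        have : S' ⊆ (S' ∩ comp v) ∪ X := by
          intro z hz
          have := hle (hS'U hz)
          simp only [Finset.mem_union, Finset.mem_inter] at this ⊢
          tauto
        have := (Finset.card_le_card this).trans (Finset.card_union_le _ _)
        omega
      · intro z hz
        have := @hS'U z
        simp only [Finset.mem_union, Finset.mem_inter] at hz ⊢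
        tauto
      · refine (Finset.card_union_le _ _).trans ?_
        have := Finset.card_le_card (Finset.inter_subset_left (s₁ := X) (s₂ := U))
        omega
      · intro z hz
        simp only [Finset.mem_union, Finset.mem_inter, hNdef] at hz ⊢
        tauto
      · intro z hz
        simp only [Finset.mem_union, Finset.mem_inter, hNdef] at hz ⊢
        tauto
      · intro z hz
        rw [Finset.mem_inter, Finset.mem_inter, Finset.mem_union] at hz
        obtain ⟨⟨hzU, hzC⟩, hz⟩ := hz
        rw [Finset.mem_union, Finset.mem_inter, Finset.mem_inter]
        by_cases hzX : z ∈ X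
        · exact .inr ⟨hzX, hzU⟩
        have hzC := hzC.resolve_right hzX
        refine .inl ⟨?_, hzC⟩
        simp only [Finset.mem_union, Finset.mem_biUnion, Finset.mem_inter, hNdef] at hz
        rcases hz with (hz | hz | hz) | ⟨C', hC', -, hz⟩
        · exact hSS' (hUU (Finset.mem_inter.2 ⟨hzU, hz⟩))
        · exact hz
        · exact absurd hz.1 hzX
        · exact absurd hz (hdisj C' hC' z hzC)
      · intro a ha haS b hb hbS hab
        rw [Finset.mem_inter, Finset.mem_union] at ha
        rw [Finset.mem_union, Finset.mem_inter, Finset.mem_inter, not_or] at haS hbS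
        have haX : a ∉ X := fun h => haS.2 ⟨h, ha.1⟩
        have haC : a ∈ comp v := ha.2.resolve_right haX
        have hbX : b ∈ U → b ∉ X := fun hbU h => hbS.2 ⟨h, hbU⟩
        have hbC : b ∈ U → b ∈ comp v := fun hbU => hclosed a haC b hab (hbX hbU)
        have hbS' : b ∉ S' := fun h => hbS.1 ⟨h, hbC (hS'U h)⟩
        simp only [Finset.mem_union, Finset.mem_biUnion, Finset.mem_inter, hNdef] at hb
        rcases hb with (hb | hb | hb) | ⟨C', hC', hbU, hb⟩
        · exact hadj a ha.1 (fun h => haS.1 ⟨hSS' h, haC⟩) b hb (fun h => hbS' (hSS' h)) hab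
        · exact hbS' hb
        · exact hbX hb.2 hb.1
        · exact hdisj C' hC' b (hbC hbU) hb
  have hfin := (hiter 𝒞 subset_rfl).mono (Set.subset_insert _ _)
  convert! hfin using 1
  ext z
  simp only [Finset.mem_union, Finset.mem_biUnion, Finset.mem_inter, hNdef]
  constructor
  · rintro (hz | hz)
    · tauto
    · by_cases hzX : z ∈ X
      · tauto
      · refine .inr ⟨comp z, ?_, hz, (hcomp _ _).2 (.refl (by simpa using hzX))⟩
        exact Finset.mem_image.2 ⟨z, by simpa using hzX, rfl⟩
  · have := @hS'U z
    rintro ((hz | hz | hz) | ⟨_, _, hz, _⟩) <;> tauto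

theorem HasSeparators.treewidth_le [Finite V] {s x : ℕ} (h : G.HasSeparators s x) :
    G.treewidth ≤ s + x - 1 := by
  classical
  have := Fintype.ofFinite V
  obtain ⟨N, hN, T, bag, h1, -, h3, h4, h5, -⟩ := h.decomposable_union _ Finset.univ ∅ rfl
    (by simp) (by simp) ∅ {∅} (decomposable_empty _) ⟨∅, rfl, subset_rfl⟩ (by simp) (by simp)
    (by simp)
  let D : TreeDecomposition G := ⟨N, T, h1, bag, fun u v huv => h4 u (by simp) v (by simp) huv,
    fun v => h5 v (by simp)⟩
  refine ((isLeast_treewidth G).2 ⟨D, rfl⟩).trans ?_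
  have : (Finset.univ.sup fun x : D.Node => (D.bag x).card) ≤ s + x :=
    Finset.sup_le fun y _ => h3 y
  unfold TreeDecomposition.width
  have : ((Finset.univ.sup fun x : D.Node => (D.bag x).card : ℕ) : ℤ) ≤ ((s + x : ℕ) : ℤ) := by
    exact_mod_cast this
  push_cast at this
  linarith

end SimpleGraph

/-! ### Minors and the boundary order of an outer-string graph. -/

namespace SimpleGraph

variable {V : Type*} {G : SimpleGraph V}

theorem le_hadwigerNumber [Finite V] {k : ℕ} (P : Fin k → Set V)
    (hP : ∀ i, (G.induce (P i)).Connected) (hd : ∀ i j, i ≠ j → Disjoint (P i) (P j))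
    (hadj : ∀ i j, i ≠ j → ∃ x ∈ P i, ∃ y ∈ P j, G.Adj x y) : k ≤ G.hadwigerNumber :=
  (isGreatest_hadwigerNumber G).2 ⟨P, hP, hd, fun i j h => hadj i j h.ne⟩

theorem le_hadwigerNumber_of_pairwise_adj [Finite V] {k : ℕ} (f : Fin k → V)
    (hf : ∀ i j, i ≠ j → G.Adj (f i) (f j)) : k ≤ G.hadwigerNumber := by
  refine le_hadwigerNumber (fun i => {f i}) (fun i => ?_) (fun i j hij => ?_) fun i j hij => ?_
  · refine ReachIn.connected_induce (a := f i) rfl ?_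
    rintro _ rfl
    exact .refl rfl
  · rw [Set.disjoint_singleton]
    exact (hf i j hij).ne
  · exact ⟨_, rfl, _, rfl, hf i j hij⟩

theorem exists_adj_of_interleaving {γ : V → C(unitInterval, ℂ)}
    (hdisk : ∀ v, Set.range (γ v) ⊆ Metric.closedBall (0 : ℂ) 1)
    (hadj : ∀ v w, G.Adj v w ↔ v ≠ w ∧ (Set.range (γ v) ∩ Set.range (γ w)).Nonempty)
    {θ : V → ℝ} (hθ : ∀ v, θ v ∈ Set.Ioc (-Real.pi) Real.pi)
    (hγ : ∀ v, Complex.exp (θ v * Complex.I) ∈ Set.range (γ v))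
    {C D : Set V} (hC : (G.induce C).Connected) (hD : (G.induce D).Connected)
    (hCD : Disjoint C D) {c d c' d' : V} (hc : c ∈ C) (hd : d ∈ D) (hc' : c' ∈ C) (hd' : d' ∈ D)
    (h1 : θ c ≤ θ d) (h2 : θ d ≤ θ c') (h3 : θ c' ≤ θ d') : ∃ x ∈ C, ∃ y ∈ D, G.Adj x y := by
  have hmeet : ∀ x ∈ C, ∀ y ∈ D, (Set.range (γ x) ∩ Set.range (γ y)).Nonempty →
      ∃ x ∈ C, ∃ y ∈ D, G.Adj x y := fun x hx y hy h =>
    ⟨x, hx, y, hy, (hadj x y).2 ⟨fun hxy => Set.disjoint_left.1 hCD hx (hxy ▸ hy), h⟩⟩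
  -- Equal angles mean a shared boundary point, so only strict interleaving needs the crossing
  -- argument.
  have heq : ∀ x ∈ C, ∀ y ∈ D, θ x = θ y → ∃ x ∈ C, ∃ y ∈ D, G.Adj x y := fun x hx y hy h =>
    hmeet x hx y hy ⟨_, hγ x, h ▸ hγ y⟩
  rcases h1.eq_or_lt with h1 | h1
  · exact heq c hc d hd h1
  rcases h2.eq_or_lt with h2 | h2
  · exact heq c' hc' d hd h2.symm
  rcases h3.eq_or_lt with h3 | h3
  · exact heq c' hc' d' hd' h3
  have hI : PathConnectedSpace unitInterval := isPathConnected_iff_pathConnectedSpace.1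
    ((convex_Icc (0 : ℝ) 1).isPathConnected ⟨0, by simp⟩)
  have hjoin : ∀ {C : Set V}, (G.induce C).Connected → ∀ u ∈ C, ∀ v ∈ C,
      JoinedIn (⋃ v ∈ C, Set.range (γ v)) (Complex.exp (θ u * Complex.I))
        (Complex.exp (θ v * Complex.I)) := by
    intro C hC u hu v hv
    have hsub : ∀ x ∈ C, Set.range (γ x) ⊆ ⋃ v ∈ C, Set.range (γ v) := fun x hx =>
      Set.subset_biUnion_of_mem (u := fun v => Set.range (γ v)) hx
    have hcurve : ∀ x ∈ C, ∀ z ∈ Set.range (γ x), ∀ w ∈ Set.range (γ x),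
        JoinedIn (⋃ v ∈ C, Set.range (γ v)) z w := fun x hx z hz w hw =>
      ((isPathConnected_range (γ x).continuous).joinedIn z hz w hw).mono (hsub x hx)
    refine (hC.reachIn hu hv).induction (.refl (hsub u hu (hγ u))) ?_
    intro x y hx hxy hy ih
    obtain ⟨z, hzx, hzy⟩ := ((hadj x y).1 hxy).2
    exact ih.trans ((hcurve x hx.mem_right _ (hγ x) z hzx).trans (hcurve y hy z hzy _ (hγ y)))
  obtain ⟨z, hz, hz'⟩ := Complex.nonempty_inter_of_interleaving h1 h2 h3
    (by linarith [(hθ c).1, (hθ d').2])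
    (Set.iUnion₂_subset fun v _ => hdisk v) (Set.iUnion₂_subset fun v _ => hdisk v)
    (hjoin hC c hc c' hc') (hjoin hD d hd d' hd')
  obtain ⟨x, hx, hzx⟩ := Set.mem_iUnion₂.1 hz
  obtain ⟨y, hy, hzy⟩ := Set.mem_iUnion₂.1 hz'
  exact hmeet x hx y hy ⟨z, hzx, hzy⟩

/-- The vertices of an outer-string graph can be numbered along the boundary circle. -/
theorem IsOuterString.exists_numbering [Finite V] (hG : G.IsOuterString) :
    ∃ f : V → ℕ, Function.Injective f ∧ ∀ C D : Set V, (G.induce C).Connected →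
      (G.induce D).Connected → Disjoint C D → ∀ c ∈ C, ∀ d ∈ D, ∀ c' ∈ C, ∀ d' ∈ D,
        f c < f d → f d < f c' → f c' < f d' → ∃ x ∈ C, ∃ y ∈ D, G.Adj x y := by
  obtain ⟨γ, hdisk, hend, hadj⟩ := hG
  have hroot : ∀ v, ∃ θ ∈ Set.Ioc (-Real.pi) Real.pi,
      Complex.exp (θ * Complex.I) ∈ Set.range (γ v) := by
    intro v
    have key : ∀ z ∈ Set.range (γ v), z ∈ Metric.sphere (0 : ℂ) 1 →
        ∃ θ ∈ Set.Ioc (-Real.pi) Real.pi, Complex.exp (θ * Complex.I) ∈ Set.range (γ v) := by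
      intro z hz hz1
      refine ⟨z.arg, Complex.arg_mem_Ioc z, ?_⟩
      have h := Complex.norm_mul_exp_arg_mul_I z
      rw [mem_sphere_zero_iff_norm.1 hz1, Complex.ofReal_one, one_mul] at h
      rwa [h]
    rcases hend v with h | h
    exacts [key _ ⟨0, rfl⟩ h, key _ ⟨1, rfl⟩ h]
  choose θ hθ hγ using hroot
  let e := Finite.equivFin V
  let σ := Tuple.sort (θ ∘ e.symm)
  have hσ : Monotone ((θ ∘ e.symm) ∘ σ) := Tuple.monotone_sort _
  have hmono : ∀ u v, (σ.symm (e u) : ℕ) < σ.symm (e v) → θ u ≤ θ v := by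
    intro u v huv
    have := hσ (Fin.le_def.2 huv.le)
    simpa using this
  refine ⟨fun v => σ.symm (e v), ?_, ?_⟩
  · exact Fin.val_injective.comp (σ.symm.injective.comp e.injective)
  · intro C D hC hD hCD c hc d hd c' hc' d' hd' h1 h2 h3
    exact exists_adj_of_interleaving hdisk hadj hθ hγ hC hD hCD hc hd hc' hd' (hmono _ _ h1)
      (hmono _ _ h2) (hmono _ _ h3)

/-! ### Separating three colour classes. -/

/-- The graph obtained by deleting the edges between the two colour classes other than `l`. -/
def deleteOpposite (G : SimpleGraph V) (ℓ : V → Fin 3) (l : Fin 3) : SimpleGraph V where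
  Adj u v := G.Adj u v ∧ (ℓ u = ℓ v ∨ ℓ u = l ∨ ℓ v = l)
  symm := ⟨fun _ _ h => ⟨h.1.symm, h.2.elim (fun h => .inl h.symm) fun h => .inr h.symm⟩⟩
  loopless := ⟨fun _ h => h.1.ne rfl⟩

/-- A path from colour `l + 1` to colour `l + 2` in the auxiliary graph must pass through colour
`l`, so it meets all three classes. Hence there are no `k + 1` disjoint ones, and Menger's theorem
applies. -/
theorem exists_separator_deleteOpposite [Finite V] {ℓ : V → Fin 3} {k : ℕ}
    (h : ∀ P : Fin (k + 1) → Set V, (∀ i, (G.induce (P i)).Connected) →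
      (∀ i j, i ≠ j → Disjoint (P i) (P j)) → ¬ ∀ i l, ∃ v ∈ P i, ℓ v = l) (l : Fin 3) :
    ∃ X : Finset V, X.card ≤ k ∧
      (G.deleteOpposite ℓ l).Separates X {v | ℓ v = l + 1} {v | ℓ v = l + 2} := by
  have hfin : ∀ l : Fin 3, l ≠ l + 1 ∧ l + 1 ≠ l + 2 ∧ ∀ m, m = l ∨ m = l + 1 ∨ m = l + 2 := by
    decide
  by_contra! hX
  obtain ⟨P, hd, hP⟩ := hasDisjointPaths_of_forall_separates (G.deleteOpposite ℓ l)
    {v | ℓ v = l + 1} {v | ℓ v = l + 2} (k + 1) fun X hsep => by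
      by_contra hk
      exact hX X (by omega) hsep
  choose a ha b hb hab using hP
  refine h (fun i => {w | G.ReachIn (P i) (a i) w})
    (fun i => ReachIn.connected_induce_setOf (hab i).1) (fun i j hij => ?_) fun i m => ?_
  · exact (hd i j hij).mono (fun w hw => hw.mem_right) (fun w hw => hw.mem_right)
  · have hle : G.deleteOpposite ℓ l ≤ G := fun u v h => h.1
    have hl : ∃ w, G.ReachIn (P i) (a i) w ∧ ℓ w = l := by
      have : ℓ (b i) = l + 1 ∨ ∃ w, G.ReachIn (P i) (a i) w ∧ ℓ w = l := by
        refine (hab i).induction (.inl (ha i)) ?_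
        rintro u v hu huv hv (ih | ih)
        · rcases huv.2 with h | h | h
          · exact .inl (h ▸ ih)
          · rw [h] at ih
            exact absurd ih (hfin l).1
          · exact .inr ⟨v, (hu.tail huv hv).mono hle subset_rfl, h⟩
        · exact .inr ih
      refine this.resolve_left fun h => ?_
      have h' : ℓ (b i) = l + 2 := hb i
      rw [h] at h'
      exact absurd h' (hfin l).2.1
    rcases (hfin l).2.2 m with rfl | rfl | rfl
    · exact hl
    · exact ⟨a i, .refl (hab i).1, ha i⟩
    · exact ⟨b i, (hab i).mono hle subset_rfl, hb i⟩

/-- If a monochromatic connected piece had neighbours of both other colours, a walk through it would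
join these two colours in the auxiliary graph for the colour of the piece. -/
theorem eq_of_monochromatic_reachIn {ℓ : V → Fin 3} {X : Set V}
    (hX : ∀ l u v, ℓ u = l + 1 → ℓ v = l + 2 → ¬ (G.deleteOpposite ℓ l).ReachIn X u v)
    {p q p' q' : V} (hpq : G.ReachIn (X ∩ {v | ℓ v = ℓ p}) p q) (hp : G.Adj p p')
    (hq : G.Adj q q') (hp' : p' ∈ X) (hq' : q' ∈ X) (hpl : ℓ p' ≠ ℓ p) (hql : ℓ q' ≠ ℓ p) :
    ℓ p' = ℓ q' := by
  by_contra hne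
  have hqp : ℓ q = ℓ p := hpq.mem_right.2
  have h1 : (G.deleteOpposite ℓ (ℓ p)).ReachIn X p q :=
    hpq.induction (.refl hpq.1.1) fun u v hu huv hv ih =>
      ih.tail ⟨huv, .inr (.inr hv.2)⟩ hv.1
  have h0 : (G.deleteOpposite ℓ (ℓ p)).Adj p' p := ⟨hp.symm, .inr (.inr rfl)⟩
  have h2 : (G.deleteOpposite ℓ (ℓ p)).ReachIn X p' q' :=
    ((ReachIn.refl hp').tail h0 hpq.1.1).trans (h1.tail ⟨hq, .inr (.inl hqp)⟩ hq')
  have h3 : ∀ x y z : Fin 3, y ≠ x → z ≠ x → y ≠ z →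
      y = x + 1 ∧ z = x + 2 ∨ z = x + 1 ∧ y = x + 2 := by decide
  rcases h3 _ _ _ hpl hql hne with ⟨h, h'⟩ | ⟨h, h'⟩
  · exact hX _ _ _ h h' h2
  · exact hX _ _ _ h h' h2.symm

/-- Each monochromatic piece has neighbours of at most one other colour. Moving from a piece to a
neighbouring one, the same two colours must alternate, so a component sees at most two colours. -/
theorem exists_color_not_reachIn {ℓ : V → Fin 3} {X : Set V}
    (hX : ∀ l u v, ℓ u = l + 1 → ℓ v = l + 2 → ¬ (G.deleteOpposite ℓ l).ReachIn X u v)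
    {v : V} (hv : v ∈ X) : ∃ l, ∀ u, G.ReachIn X v u → ℓ u ≠ l := by
  by_cases hmono : ∀ q q', G.ReachIn (X ∩ {u | ℓ u = ℓ v}) v q → G.Adj q q' → q' ∈ X → ℓ q' = ℓ v
  · refine ⟨ℓ v + 1, fun u hu => ?_⟩
    have : G.ReachIn (X ∩ {u | ℓ u = ℓ v}) v u :=
      hu.induction (.refl ⟨hv, rfl⟩) fun x y _ hxy hy ih => ih.tail hxy ⟨hy, hmono x y ih hxy hy⟩
    have h : ℓ u = ℓ v := this.mem_right.2
    rw [h]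
    generalize ℓ v = x
    revert x; decide
  push Not at hmono
  obtain ⟨q, q', hq, hqq', hq', hne⟩ := hmono
  have h3 : ∀ x y : Fin 3, ∃ z, z ≠ x ∧ z ≠ y := by decide
  obtain ⟨l, hl1, hl2⟩ := h3 (ℓ v) (ℓ q')
  refine ⟨l, fun u hu => ?_⟩
  -- The invariant along a walk: the piece of `u` also has a neighbour of the second colour, which
  -- forces every exit from that piece to have this colour.
  have key : (ℓ u ≠ l) ∧ ∃ p p', G.ReachIn (X ∩ {w | ℓ w = ℓ u}) u p ∧ G.Adj p p' ∧ p' ∈ X ∧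
      ℓ p' ≠ ℓ u ∧ ℓ p' ≠ l := by
    refine hu.induction ⟨hl1.symm, q, q', hq, hqq', hq', hne, hl2.symm⟩ ?_
    rintro x y hx hxy hy ⟨hxl, p, p', hp, hpp', hp', hpx, hpl⟩
    by_cases hyx : ℓ y = ℓ x
    · refine ⟨hyx ▸ hxl, p, p', ?_, hpp', hp', hyx ▸ hpx, hpl⟩
      rw [hyx]
      have hy' : y ∈ X ∩ {w | ℓ w = ℓ x} := ⟨hy, hyx⟩
      exact ((ReachIn.refl hy').tail hxy.symm hp.1).trans hp
    · have := eq_of_monochromatic_reachIn hX hp hxy hpp' hy hp' hyx hpx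
      exact ⟨this ▸ hpl, y, x, .refl ⟨hy, rfl⟩, hxy.symm, hx.mem_right, Ne.symm hyx, hxl⟩
  exact key.1

/-- Unless `k + 1` disjoint connected sets each meet all three colour classes, some `3 * k`
vertices meet all connected sets that do so. -/
theorem exists_separator_of_three_coloring [Finite V] {ℓ : V → Fin 3} {k : ℕ}
    (h : ∀ P : Fin (k + 1) → Set V, (∀ i, (G.induce (P i)).Connected) →
      (∀ i j, i ≠ j → Disjoint (P i) (P j)) → ¬ ∀ i l, ∃ v ∈ P i, ℓ v = l) :
    ∃ X : Finset V, X.card ≤ 3 * k ∧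
      ∀ v ∉ X, ∃ l, ∀ u, G.ReachIn (X : Set V)ᶜ v u → ℓ u ≠ l := by
  classical
  choose X hXk hX using exists_separator_deleteOpposite h
  refine ⟨Finset.univ.biUnion X, ?_, fun v hv => ?_⟩
  · simpa using Finset.card_biUnion_le_card_mul Finset.univ X k fun l _ => hXk l
  · refine exists_color_not_reachIn ?_ (by simpa using hv)
    intro l u w hu hw huw
    refine hX l u hu w hw (huw.mono le_rfl ?_)
    rw [Set.compl_subset_compl, Finset.coe_subset]
    exact Finset.subset_biUnion_of_mem X (Finset.mem_univ l)

end SimpleGraph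

/-! ### Cutting a numbered set into intervals. -/

theorem Finset.exists_card_filter_lt_eq (T : Finset ℕ) {r : ℕ} (hr : r ≤ T.card) :
    ∃ m, (T.filter (· < m)).card = r := by
  induction r with
  | zero => exact ⟨0, by simp⟩
  | succ r ih =>
    obtain ⟨m, hm⟩ := ih (by omega)
    have hne : (T.filter (¬ · < m)).Nonempty := by
      rw [← Finset.card_pos]
      have := T.card_filter_add_card_filter_not (· < m)
      omega
    have hmin := Finset.min'_mem _ hne
    set z := (T.filter (¬ · < m)).min' hne with hz
    rw [Finset.mem_filter] at hmin
    -- `z` is the least element not below `m`, so this threshold adds exactly one element.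
    refine ⟨z + 1, ?_⟩
    have : T.filter (· < z + 1) = insert z (T.filter (· < m)) := by
      ext w
      simp only [Finset.mem_filter, Finset.mem_insert]
      constructor
      · rintro ⟨hw, hwz⟩
        by_cases hwm : w < m
        · exact .inr ⟨hw, hwm⟩
        · have : z ≤ w := Finset.min'_le _ _ (Finset.mem_filter.2 ⟨hw, hwm⟩)
          exact .inl (by omega)
      · rintro (rfl | ⟨hw, hwm⟩)
        · exact ⟨hmin.1, by omega⟩
        · exact ⟨hw, by omega⟩
    rw [this, Finset.card_insert_of_notMem, hm]
    simp only [Finset.mem_filter, not_and]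
    exact fun _ => hmin.2

/-- A set of `3 * r` numbered elements is cut into three intervals of `r` elements. -/
theorem Finset.exists_three_intervals {V : Type*} {f : V → ℕ} (hf : Function.Injective f)
    (S : Finset V) {r : ℕ} (hS : S.card = 3 * r) :
    ∃ ℓ : V → Fin 3, (∀ u v, ℓ u < ℓ v → f u < f v) ∧ ∀ l, (S.filter (ℓ · = l)).card = r := by
  classical
  have hcard : ∀ k ≤ 3 * r, ∃ m, (S.filter (f · < m)).card = k := by
    intro k hk
    obtain ⟨m, hm⟩ := (S.image f).exists_card_filter_lt_eq (r := k)
      (by rw [Finset.card_image_of_injective _ hf]; omega)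
    refine ⟨m, ?_⟩
    rw [← hm, Finset.filter_image, Finset.card_image_of_injective _ hf]
  obtain ⟨m₁, hm₁⟩ := hcard r (by omega)
  obtain ⟨m₂, hm₂⟩ := hcard (2 * r) (by omega)
  have hle : ∀ v ∈ S, f v < m₁ → f v < m₂ := by
    intro v hv hv1
    by_contra hv2
    have : S.filter (f · < m₂) ⊂ S.filter (f · < m₁) := by
      refine ⟨fun u hu => ?_, fun hsub => ?_⟩
      · rw [Finset.mem_filter] at hu ⊢
        exact ⟨hu.1, by omega⟩
      · have := hsub (Finset.mem_filter.2 ⟨hv, hv1⟩)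
        exact hv2 (Finset.mem_filter.1 this).2
    have := Finset.card_lt_card this
    omega
  refine ⟨fun v => if f v < m₁ then 0 else if f v < m₂ then 1 else 2, ?_, ?_⟩
  · intro u v
    dsimp only
    split_ifs <;> simp <;> omega
  · have h0 : S.filter (fun v => (if f v < m₁ then (0 : Fin 3) else if f v < m₂ then 1 else 2) = 0) =
        S.filter (f · < m₁) := by
      refine Finset.filter_congr fun v _ => ?_
      split_ifs <;> simp_all
    have h1 : S.filter (fun v => (if f v < m₁ then (0 : Fin 3) else if f v < m₂ then 1 else 2) = 1) =
        S.filter (f · < m₂) \ S.filter (f · < m₁) := by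
      ext v
      simp only [Finset.mem_filter, Finset.mem_sdiff]
      split_ifs <;> simp_all
    have h2 : S.filter (fun v => (if f v < m₁ then (0 : Fin 3) else if f v < m₂ then 1 else 2) = 2) =
        S \ S.filter (f · < m₂) := by
      ext v
      have := hle v
      simp only [Finset.mem_filter, Finset.mem_sdiff]
      split_ifs <;> simp_all
    have hsub : S.filter (f · < m₁) ⊆ S.filter (f · < m₂) := by
      intro v hv
      rw [Finset.mem_filter] at hv ⊢
      exact ⟨hv.1, hle v hv.1 hv.2⟩
    intro l
    fin_cases l
    · exact (congrArg _ h0).trans hm₁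
    · refine (congrArg _ h1).trans ?_
      rw [Finset.card_sdiff_of_subset hsub]
      omega
    · refine (congrArg _ h2).trans ?_
      rw [Finset.card_sdiff_of_subset (Finset.filter_subset _ _)]
      omega

/-! ### Balanced separators of outer-string graphs and the final bound. -/

namespace SimpleGraph

variable {V : Type*} {G : SimpleGraph V}

theorem IsOuterString.hasSeparators [Finite V] (hG : G.IsOuterString) :
    G.HasSeparators (3 * (3 * G.hadwigerNumber + 1)) (3 * G.hadwigerNumber) := by
  classical
  obtain ⟨f, hf, hcross⟩ := hG.exists_numbering
  intro S hS
  obtain ⟨ℓ, hℓ, hcard⟩ := S.exists_three_intervals hf hS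
  obtain ⟨X, hX, hXl⟩ := exists_separator_of_three_coloring (G := G) (ℓ := ℓ)
      (k := G.hadwigerNumber) (by
    intro P hP hd hmeet
    have := le_hadwigerNumber P hP hd fun i j hij => by
      choose c hc hcl using hmeet i
      choose d hd' hdl using hmeet j
      have hlt : ∀ u v, ℓ u < ℓ v → f u < f v := hℓ
      -- The set that comes first in interval `0` is taken again in interval `1`, the other in
      -- interval `2`; this interleaves them.
      rcases lt_trichotomy (f (c 0)) (f (d 0)) with h | h | h
      · exact hcross _ _ (hP i) (hP j) (hd i j hij) _ (hc 0) _ (hd' 0) _ (hc 1) _ (hd' 2) h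
          (hℓ _ _ (by rw [hcl, hdl]; decide)) (hℓ _ _ (by rw [hcl, hdl]; decide))
      · exact absurd (hf h ▸ hd' 0) (Set.disjoint_left.1 (hd i j hij) (hc 0))
      · obtain ⟨x, hx, y, hy, hxy⟩ := hcross _ _ (hP j) (hP i) (hd i j hij).symm _ (hd' 0) _ (hc 0)
          _ (hd' 1) _ (hc 2) h
          (hℓ _ _ (by rw [hcl, hdl]; decide)) (hℓ _ _ (by rw [hcl, hdl]; decide))
        exact ⟨y, hy, x, hx, hxy.symm⟩
    omega)
  refine ⟨X, hX, ?_⟩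
  rintro C ⟨v, hv, hC⟩ D hDS hDC
  obtain ⟨l, hl⟩ := hXl v hv
  have hsub : D ⊆ S \ S.filter (ℓ · = l) := by
    intro u hu
    have huC : G.ReachIn (X : Set V)ᶜ v u := by
      have : u ∈ (C : Set V) := hDC hu
      rwa [hC] at this
    rw [Finset.mem_sdiff, Finset.mem_filter]
    exact ⟨hDS hu, fun h => hl u huC h.2⟩
  have h1 := Finset.card_le_card hsub
  rw [Finset.card_sdiff_of_subset (Finset.filter_subset _ _), hcard l] at h1
  omega

theorem hasSeparators_bot : (⊥ : SimpleGraph V).HasSeparators 2 0 := by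
  intro S _
  refine ⟨∅, le_rfl, ?_⟩
  rintro C ⟨v, -, hC⟩ D - hDC
  have : D ⊆ {v} := by
    intro u hu
    have : u ∈ (C : Set V) := hDC hu
    rw [hC] at this
    rw [Finset.mem_singleton]
    exact ReachIn.induction this rfl fun x y _ hxy _ _ => absurd hxy (by simp)
  have := Finset.card_le_card this
  rw [Finset.card_singleton] at this
  rw [Finset.card_empty]
  omega

end SimpleGraph

theorem theorem4 {V : Type*} [Finite V] [Nonempty V] (G : SimpleGraph V)
    (hG : G.IsOuterString) :
    G.treewidth ≤ 15 * (G.hadwigerNumber : ℤ) - 2 := by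
  -- The bound `12h + 2 ≤ 15h - 2` needs `h ≥ 2`, hence an edge. Without edges the components are
  -- single vertices and the treewidth is at most `1`.
  by_cases hbot : G = ⊥
  · subst hbot
    have h1 : 1 ≤ (⊥ : SimpleGraph V).hadwigerNumber :=
      SimpleGraph.le_hadwigerNumber_of_pairwise_adj (fun _ => Classical.arbitrary V)
        fun i j hij => absurd (Subsingleton.elim i j) hij
    have h2 := (SimpleGraph.hasSeparators_bot (V := V)).treewidth_le
    push_cast at h2
    omega
  · obtain ⟨x, y, hxy⟩ := SimpleGraph.ne_bot_iff_exists_adj.1 hbot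
    have h1 : 2 ≤ G.hadwigerNumber := by
      refine SimpleGraph.le_hadwigerNumber_of_pairwise_adj ![x, y] fun i j hij => ?_
      fin_cases i <;> fin_cases j <;> first | exact absurd rfl hij | exact hxy | exact hxy.symm
    have h2 := hG.hasSeparators.treewidth_le
    push_cast at h2
    omega
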